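/- Let $A$ and $B$ be finite-dimensional quantum systems ($\dim A\ge 1$) with fixed orthonormal (incoherent) bases $|i\rangle$; composed systems carry the product basis. Let $\Delta(X)=\sum_i |i\rangle\langle i|X|i\rangle\langle i|$ denote total dephasing in the incoherent basis of the system in question. A quantum operation is a completely positive trace-preserving linear map, and $\mathcal{DI}$ is the set of quantum operations $\Phi$ from $A$ to $B$ with $\Delta\Phi=\Delta\Phi\Delta$. Put $\|X\|_1=\operatorname{tr}\sqrt{X^\dagger X}$, let $\|X\|_\infty$ be the operator norm, and for a linear map $\Lambda$ from operators on $A$ to operators on $B$ let $$\|\Lambda\|_\diamond=\sup_C\ \max\{\|(\Lambda\otimes \mathbb 1_C)(X)\|_1:\ \|X\|_1\le 1\},$$ where $C$ runs over all finite-dimensional auxiliary systems. For a quantum operation $\Theta$ from $A$ to $B$ define the diamond-measure $$M_\diamond(\Theta)=\min_{\Phi\in\mathcal{DI}}\|\Delta\Theta-\Delta\Phi\|_\diamond$$ and the Choi matrix $J(\Lambda)=\sum_{i,j}\Lambda(|i\rangle\langle j|)\otimes|i\rangle\langle j|$, an operator on $B\otimes A$. Then the minimum defining $M_\diamond(\Theta)$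 exists, and $M_\diamond(\Theta)$ is the optimal value of each of the following two semidefinite programs, in both of which the optimum is attained. Primal problem, over operators $Z,W$ on $B\otimes A$: minimize $2\|\operatorname{tr}_B Z\|_\infty$ subject to $$Z\ge J(\Delta\Theta)-W,\quad [\mathbb 1-\Delta]W=0,\quad \operatorname{tr}_B W=\mathbb 1_A,\quad Z\ge 0,\quad W\ge 0.$$ Dual problem, over operators $X,Y_1$ on $B\otimes A$ and $Y_2,\rho$ on $A$: maximize $2\left(\operatorname{tr}(J(\Delta\Theta)X)-\operatorname{tr}Y_2\right)$ subject to $$X\le \mathbb 1_B\otimes\rho,\quad \rho\ge 0,\quad \operatorname{tr}\rho=1,\quad [\mathbb 1-\Delta]Y_1-X+\mathbb 1_B\otimes Y_2\ge 0,\quad X\ge 0,\quad Y_1=Y_1^\dagger,\quad Y_2=Y_2^\dagger.$$ In particular strong duality holds. Moreover, the primal problem has a strictly feasible point: there are $Z,W$ satisfying the two equality constraints for which $Z-J(\Delta\Theta)+W$, $Z$ and $W$ are all positive definite. -/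

import Mathlib

open scoped Matrix Kronecker ComplexOrder MatrixOrder

namespace CoherenceSDP

/-- The trace norm `‖M‖₁ = tr √(M† M)`. -/
noncomputable def traceNorm {n : Type*} [Fintype n] [DecidableEq n] (M : Matrix n n ℂ) : ℝ :=
  (CFC.sqrt (Mᴴ * M)).trace.re

/-- The norm `‖M‖_∞`: the operator norm of `M` acting on the Hilbert space `ℂⁿ`
(its largest singular value). -/
noncomputable def operatorNorm {n : Type*} [Fintype n] [DecidableEq n] (M : Matrix n n ℂ) : ℝ :=
  ‖Matrix.toEuclideanCLM (n := n) (𝕜 := ℂ) M‖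

/-- The total dephasing operation `Δ(X) = ∑ i, |i⟩⟨i| X |i⟩⟨i|` with respect to the standard
(incoherent) basis: it keeps the diagonal of `X` and deletes everything else. On a composed
system `n × m` the incoherent basis is the product basis. -/
def dephasing (n : Type*) [DecidableEq n] : Matrix n n ℂ →ₗ[ℂ] Matrix n n ℂ where
  toFun X := Matrix.diagonal X.diag
  map_add' X Y := by simp
  map_smul' c X := by simp

/-- The partial trace over the first tensor factor. -/
def partialTraceFst {B A : Type*} [Fintype B] (M : Matrix (B × A) (B × A) ℂ) : Matrix A A ℂ :=
  Matrix.of fun a a' => ∑ b, M (b, a) (b, a')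

/-- The map `Θ ⊗ 𝟙_C` for a super-operator `Θ` from system `A` to system `B` and an auxiliary
system `C`: `Θ` is applied to each `C`-block. -/
def tensorId {A B : Type*} (Θ : Matrix A A ℂ →ₗ[ℂ] Matrix B B ℂ) (C : Type*) :
    Matrix (A × C) (A × C) ℂ →ₗ[ℂ] Matrix (B × C) (B × C) ℂ where
  toFun M := Matrix.of fun x y => Θ (Matrix.of fun a a' => M (a, x.2) (a', y.2)) x.1 y.1
  map_add' M N := by
    ext x y
    exact congrFun (congrFun (map_add Θ (Matrix.of fun a a' => M (a, x.2) (a', y.2))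
      (Matrix.of fun a a' => N (a, x.2) (a', y.2))) x.1) y.1
  map_smul' c M := by
    ext x y
    exact congrFun (congrFun (map_smul Θ c (Matrix.of fun a a' => M (a, x.2) (a', y.2))) x.1) y.1

/-- A quantum operation (channel): a completely positive and trace preserving linear map. -/
structure IsQuantumOperation {A B : Type*} [Fintype A] [Fintype B]
    (Θ : Matrix A A ℂ →ₗ[ℂ] Matrix B B ℂ) : Prop where
  completelyPositive : ∀ (k : ℕ) (M : Matrix (A × Fin k) (A × Fin k) ℂ),
    M.PosSemidef → (tensorId Θ (Fin k) M).PosSemidef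
  tracePreserving : ∀ X : Matrix A A ℂ, (Θ X).trace = X.trace

/-- The set `DI` of detection-incoherent operations: the quantum operations `Φ` with
`Δ Φ = Δ Φ Δ`. -/
def detectionIncoherent (A B : Type*) [Fintype A] [DecidableEq A] [Fintype B] [DecidableEq B] :
    Set (Matrix A A ℂ →ₗ[ℂ] Matrix B B ℂ) :=
  {Φ | IsQuantumOperation Φ ∧ dephasing B ∘ₗ Φ = dephasing B ∘ₗ Φ ∘ₗ dephasing A}

/-- The induced trace norm `‖Θ‖₁ = max {‖Θ(X)‖₁ : ‖X‖₁ ≤ 1}` of a super-operator. -/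
noncomputable def inducedTraceNorm {A B : Type*} [Fintype A] [DecidableEq A] [Fintype B]
    [DecidableEq B] (Θ : Matrix A A ℂ →ₗ[ℂ] Matrix B B ℂ) : ℝ :=
  sSup {r : ℝ | ∃ X : Matrix A A ℂ, traceNorm X ≤ 1 ∧ r = traceNorm (Θ X)}

/-- The diamond norm (completely bounded trace norm): the supremum of `‖Θ ⊗ 𝟙_C‖₁` over all
finite-dimensional auxiliary systems `C`. -/
noncomputable def diamondNorm {A B : Type*} [Fintype A] [DecidableEq A] [Fintype B]
    [DecidableEq B] (Θ : Matrix A A ℂ →ₗ[ℂ] Matrix B B ℂ) : ℝ :=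
  ⨆ k : ℕ, inducedTraceNorm (tensorId Θ (Fin k))

/-- The values `‖Δ Θ - Δ Φ‖_⋄` for detection-incoherent `Φ`. -/
def diamondDistances {A B : Type*} [Fintype A] [DecidableEq A] [Fintype B] [DecidableEq B]
    (Θ : Matrix A A ℂ →ₗ[ℂ] Matrix B B ℂ) : Set ℝ :=
  {r | ∃ Φ ∈ detectionIncoherent A B,
    r = diamondNorm (dephasing B ∘ₗ Θ - dephasing B ∘ₗ Φ)}

/-- The diamond-measure `M_⋄(Θ) = min_{Φ ∈ DI} ‖Δ Θ - Δ Φ‖_⋄`. -/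
noncomputable def diamondMeasure {A B : Type*} [Fintype A] [DecidableEq A] [Fintype B]
    [DecidableEq B] (Θ : Matrix A A ℂ →ₗ[ℂ] Matrix B B ℂ) : ℝ :=
  sInf (diamondDistances Θ)

/-- The Choi matrix `J(Θ) = ∑ i j, Θ(|i⟩⟨j|) ⊗ |i⟩⟨j|`, an operator on `B ⊗ A`. -/
def choi {A B : Type*} [Fintype A] [DecidableEq A] (Θ : Matrix A A ℂ →ₗ[ℂ] Matrix B B ℂ) :
    Matrix (B × A) (B × A) ℂ :=
  ∑ i, ∑ j, Θ (Matrix.single i j 1) ⊗ₖ Matrix.single i j 1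

/-- The constraints of the primal problem. -/
structure PrimalFeasible {A B : Type*} [Fintype A] [DecidableEq A] [Fintype B] [DecidableEq B]
    (Θ : Matrix A A ℂ →ₗ[ℂ] Matrix B B ℂ) (Z W : Matrix (B × A) (B × A) ℂ) : Prop where
  le_Z : choi (dephasing B ∘ₗ Θ) - W ≤ Z
  dephasing_W : W - dephasing (B × A) W = 0
  trace_W : partialTraceFst W = 1
  Z_nonneg : 0 ≤ Z
  W_nonneg : 0 ≤ W

/-- The constraints of the primal problem, with all inequalities strict
(`M > 0` meaning that `M` is positive definite). -/
structure PrimalStrictlyFeasible {A B : Type*} [Fintype A] [DecidableEq A] [Fintype B]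
    [DecidableEq B] (Θ : Matrix A A ℂ →ₗ[ℂ] Matrix B B ℂ)
    (Z W : Matrix (B × A) (B × A) ℂ) : Prop where
  lt_Z : (Z - (choi (dephasing B ∘ₗ Θ) - W)).PosDef
  dephasing_W : W - dephasing (B × A) W = 0
  trace_W : partialTraceFst W = 1
  Z_pos : Z.PosDef
  W_pos : W.PosDef

/-- The values of the primal objective `2 ‖tr_B Z‖_∞` at feasible points. -/
def primalValues {A B : Type*} [Fintype A] [DecidableEq A] [Fintype B] [DecidableEq B]
    (Θ : Matrix A A ℂ →ₗ[ℂ] Matrix B B ℂ) : Set ℝ :=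
  {r | ∃ Z W : Matrix (B × A) (B × A) ℂ,
    PrimalFeasible Θ Z W ∧ r = 2 * operatorNorm (partialTraceFst Z)}

/-- The constraints of the dual problem. -/
structure DualFeasible {A B : Type*} [Fintype A] [DecidableEq A] [Fintype B] [DecidableEq B]
    (X Y₁ : Matrix (B × A) (B × A) ℂ) (Y₂ ρ : Matrix A A ℂ) : Prop where
  X_le : X ≤ (1 : Matrix B B ℂ) ⊗ₖ ρ
  ρ_nonneg : 0 ≤ ρ
  trace_ρ : ρ.trace = 1
  nonneg : 0 ≤ (Y₁ - dephasing (B × A) Y₁) - X + (1 : Matrix B B ℂ) ⊗ₖ Y₂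
  X_nonneg : 0 ≤ X
  Y₁_hermitian : Y₁ = Y₁ᴴ
  Y₂_hermitian : Y₂ = Y₂ᴴ

/-- The values of the dual objective `2 (tr (J(ΔΘ) X) - tr Y₂)` at feasible points
(at these points the complex number in question is real). -/
def dualValues {A B : Type*} [Fintype A] [DecidableEq A] [Fintype B] [DecidableEq B]
    (Θ : Matrix A A ℂ →ₗ[ℂ] Matrix B B ℂ) : Set ℝ :=
  {r | ∃ (X Y₁ : Matrix (B × A) (B × A) ℂ) (Y₂ ρ : Matrix A A ℂ),
    DualFeasible X Y₁ Y₂ ρ ∧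
      r = 2 * ((choi (dephasing B ∘ₗ Θ) * X).trace - Y₂.trace).re}

end CoherenceSDP

/-!
For a detection-incoherent operation `Φ` the Choi matrix `W` of `ΔΦ` is diagonal, positive
semidefinite and satisfies `tr_B W = 1`, and every such `W` is the Choi matrix of a classical
channel, which is itself detection incoherent. So `M_⋄(Θ)` is the minimum over these `W` of the diamond norm
of the map with Choi matrix `H = J - W`, where `J = J(ΔΘ)` and `tr_B H = 0`. The theorem follows
from a cycle of three inequalities.

* Primal value ≥ diamond distance (`PrimalFeasible.exists_diamondDistance_le`). If `Z ≥ 0` and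
  `Z ≥ H`, the map with Choi matrix `H` is the difference of the completely positive maps with Choi
  matrices `Z` and `Z - H`, whose partial traces over `B` agree. By the Kraus representation and the
  polar decomposition of the input, each of them, tensored with an identity, scales the trace norm
  at most by `‖tr_B Z‖_∞` (`re_trace_mul_tensorId_le`).

* Diamond distance ≥ dual value (`DualFeasible.le_diamondNorm`). Pairing the dual constraint with
  `W` shows that the dual value is at most `2 tr (H X)`. Write `X = (1 ⊗ √ρ) P (1 ⊗ √ρ)` with
  `0 ≤ P ≤ 1`. Then `tr (H X) = tr (K P)`, where `K` is the output of the map for the canonical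
  purification of `ρ` as input. As `K` is Hermitian of trace zero, `2 tr (K P) ≤ ‖K‖₁`. A
  state `ρ` that is not invertible is approximated by invertible ones.

* Optimal dual value ≥ optimal primal value (`exists_primal_dual_optimal`). The Lagrangian
  `tr (Z (1 ⊗ ρ)) + tr ((J - W - Z) X)` is affine and continuous in `(Z, W)` and in `(X, ρ)`. On the
  compact convex sets given by `0 ≤ X ≤ 1` and by a large enough bound on `tr Z` it has a saddle
  point by Sion's minimax theorem. The bound on `tr Z` is not active there, which forces
  `X ≤ 1 ⊗ ρ`. The bound `X ≤ 1` is an exact penalty: replacing `Z` by `Z + (J - W - Z)⁺` makes it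
  feasible and does not raise the objective above the value of the saddle point.

The last step also produces points at which both optima are attained, so that no separate
compactness argument is needed.
-/

namespace CoherenceSDP

/-! ### Positive semidefinite matrices and the polar decomposition -/

section PSD
variable {n : Type*} [Fintype n]

theorem re_trace_mul_nonneg {P Q : Matrix n n ℂ} (hP : 0 ≤ P) (hQ : 0 ≤ Q) :
    0 ≤ (P * Q).trace.re := by
  classical
  obtain ⟨R, rfl⟩ := CStarAlgebra.nonneg_iff_eq_star_mul_self.mp hP
  have h := ((Matrix.nonneg_iff_posSemidef.mp hQ).mul_mul_conjTranspose_same R).trace_nonneg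
  rw [Matrix.star_eq_conjTranspose, mul_assoc, Matrix.trace_mul_comm]
  exact (Complex.le_def.mp h).1

theorem re_trace_mul_le_left {P Q R : Matrix n n ℂ} (hPQ : P ≤ Q) (hR : 0 ≤ R) :
    (P * R).trace.re ≤ (Q * R).trace.re := by
  have h := re_trace_mul_nonneg (sub_nonneg.mpr hPQ) hR
  rw [sub_mul, Matrix.trace_sub, Complex.sub_re] at h
  linarith

theorem re_trace_mul_le_right {P Q R : Matrix n n ℂ} (hPQ : P ≤ Q) (hR : 0 ≤ R) :
    (R * P).trace.re ≤ (R * Q).trace.re := by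
  rw [Matrix.trace_mul_comm R P, Matrix.trace_mul_comm R Q]
  exact re_trace_mul_le_left hPQ hR

theorem re_trace_nonneg {P : Matrix n n ℂ} (hP : 0 ≤ P) : 0 ≤ P.trace.re :=
  (Complex.le_def.mp (Matrix.nonneg_iff_posSemidef.mp hP).trace_nonneg).1

theorem re_trace_conjTranspose (M : Matrix n n ℂ) : Mᴴ.trace.re = M.trace.re := by
  rw [Matrix.trace_conjTranspose]; simp

/-- The cone of positive semidefinite matrices is self-dual. -/
theorem nonneg_of_re_trace_mul_nonneg {M : Matrix n n ℂ} (hM : M.IsHermitian)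
    (h : ∀ Z : Matrix n n ℂ, 0 ≤ Z → 0 ≤ (Z * M).trace.re) : 0 ≤ M := by
  rw [Matrix.nonneg_iff_posSemidef, Matrix.posSemidef_iff_dotProduct_mulVec]
  refine ⟨hM, fun x => ?_⟩
  have h1 := h _ (Matrix.posSemidef_vecMulVec_self_star x).nonneg
  rw [Matrix.vecMulVec_mul, Matrix.trace_vecMulVec, ← dotProduct_comm,
    ← Matrix.dotProduct_mulVec] at h1
  exact Complex.le_def.mpr ⟨h1, (hM.im_star_dotProduct_mulVec_self x).symm⟩

variable [DecidableEq n]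

/-- **Polar decomposition** `M = U |M|` of a square matrix, with a partial isometry `U`. -/
theorem exists_polar (M : Matrix n n ℂ) : ∃ U : Matrix n n ℂ,
    U * CFC.sqrt (Mᴴ * M) = M ∧ Uᴴ * U * CFC.sqrt (Mᴴ * M) = CFC.sqrt (Mᴴ * M) ∧
      U * Uᴴ ≤ 1 := by
  have hMM : (0 : Matrix n n ℂ) ≤ Mᴴ * M := (Matrix.posSemidef_conjTranspose_mul_self M).nonneg
  have hS2 : CFC.sqrt (Mᴴ * M) * CFC.sqrt (Mᴴ * M) = Mᴴ * M := CFC.sqrt_mul_sqrt_self _ hMM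
  have hS0 : 0 ≤ CFC.sqrt (Mᴴ * M) := CFC.sqrt_nonneg _
  set S := CFC.sqrt (Mᴴ * M) with hS
  have hSsa : IsSelfAdjoint S := IsSelfAdjoint.of_nonneg hS0
  have hfin : (spectrum ℝ S).Finite := Matrix.finite_real_spectrum
  have hc : ∀ f : ℝ → ℝ, ContinuousOn f (spectrum ℝ S) := fun f => hfin.continuousOn f
  -- the pseudo-inverse of `S`, for which the convention `0⁻¹ = 0` is what is wanted
  set G := cfc (fun x : ℝ => x⁻¹) S with hG
  have hGsa : Gᴴ = G := cfc_predicate (fun x : ℝ => x⁻¹) S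
  have hSid : cfc (fun x : ℝ => x) S = S := cfc_id' ℝ S
  have hmul : ∀ f g : ℝ → ℝ, cfc f S * cfc g S = cfc (fun x => f x * g x) S :=
    fun f g => (cfc_mul f g S (hc f) (hc g)).symm
  have hGS : G * S = S * G := by
    calc G * S = G * cfc (fun x : ℝ => x) S := by rw [hSid]
      _ = cfc (fun x : ℝ => x) S * G := by simp only [hG, hmul, mul_comm]
      _ = S * G := by rw [hSid]
  have hSGS : S * G * S = S := by
    calc S * G * S = cfc (fun x : ℝ => x) S * G * cfc (fun x : ℝ => x) S := by rw [hSid]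
      _ = cfc (fun x : ℝ => x) S := by simp only [hG, hmul, mul_inv_mul_cancel]
      _ = S := hSid
  have hGSG : G * S * G = G := by
    calc G * S * G = G * cfc (fun x : ℝ => x) S * G := by rw [hSid]
      _ = G := by
        have : ∀ x : ℝ, x⁻¹ * x * x⁻¹ = x⁻¹ := fun x => by simpa using mul_inv_mul_cancel x⁻¹
        simp only [hG, hmul, this]
  refine ⟨M * G, ?_, ?_, ?_⟩
  · have h0 : (M - M * G * S)ᴴ * (M - M * G * S) = 0 := by
      have e : (M - M * G * S)ᴴ * (M - M * G * S) =
          (1 - G * S)ᴴ * (Mᴴ * M) * (1 - G * S) := by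
        simp only [Matrix.conjTranspose_sub, Matrix.conjTranspose_mul, Matrix.conjTranspose_one]
        noncomm_ring
      have e2 : S * (1 - G * S) = 0 := by rw [mul_sub, ← mul_assoc, hSGS, mul_one, sub_self]
      rw [e, ← hS2, mul_assoc, mul_assoc S, e2]
      simp
    exact (sub_eq_zero.mp (Matrix.conjTranspose_mul_self_eq_zero.mp h0)).symm
  · rw [Matrix.conjTranspose_mul, hGsa]
    calc G * Mᴴ * (M * G) * S = G * (Mᴴ * M) * (G * S) := by noncomm_ring
      _ = G * S * (S * G * S) := by rw [← hS2]; noncomm_ring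
      _ = S := by rw [hSGS, hGS, hSGS]
  · have hE : (M * G * (M * G)ᴴ) * (M * G * (M * G)ᴴ) = M * G * (M * G)ᴴ := by
      rw [Matrix.conjTranspose_mul, hGsa]
      calc M * G * (G * Mᴴ) * (M * G * (G * Mᴴ)) = M * G * (G * (Mᴴ * M) * G) * (G * Mᴴ) := by
            noncomm_ring
        _ = M * (G * S * G) * (G * S * G) * Mᴴ := by
            have : G * (S * S) * G = S * G * (G * S) := by
              rw [← hGS, ← mul_assoc, mul_assoc (G * S), ← hGS]
            rw [← hS2, this]; simp only [mul_assoc]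
        _ = M * G * (G * Mᴴ) := by rw [hGSG]; simp only [mul_assoc]
    set E := M * G * (M * G)ᴴ with hEdef
    have hEh : Eᴴ = E := by simp [hEdef]
    rw [Matrix.le_iff]
    have : (1 - E) = (1 - E)ᴴ * (1 - E) := by
      rw [Matrix.conjTranspose_sub, Matrix.conjTranspose_one, hEh]
      simp [mul_sub, sub_mul, hE]
    rw [this]
    exact Matrix.posSemidef_conjTranspose_mul_self _

/-- The polar decomposition `M = U S`, where the trace of `S = |M|` is the trace norm of `M`. -/
theorem exists_polar_traceNorm (M : Matrix n n ℂ) : ∃ U S : Matrix n n ℂ,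
    0 ≤ S ∧ U * S = M ∧ Uᴴ * U * S = S ∧ U * Uᴴ ≤ 1 ∧ S.trace.re = traceNorm M := by
  obtain ⟨U, h1, h2, h3⟩ := exists_polar M
  exact ⟨U, _, CFC.sqrt_nonneg _, h1, h2, h3, rfl⟩

end PSD

/-! ### The trace norm -/

section TraceNorm
variable {n : Type*} [Fintype n] [DecidableEq n]

theorem traceNorm_eq_re_trace_of_nonneg {M : Matrix n n ℂ} (hM : 0 ≤ M) :
    traceNorm M = M.trace.re := by
  have h : Mᴴ = M := (Matrix.nonneg_iff_posSemidef.mp hM).isHermitian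
  rw [traceNorm, h, CFC.sqrt_mul_self M hM]

theorem traceNorm_zero : traceNorm (0 : Matrix n n ℂ) = 0 := by
  rw [traceNorm_eq_re_trace_of_nonneg le_rfl]; simp

/-- The trace norm of `M` is attained by pairing `M` with a contraction. -/
theorem exists_re_trace_mul_eq_traceNorm (M : Matrix n n ℂ) : ∃ V : Matrix n n ℂ,
    V * Vᴴ ≤ 1 ∧ (Vᴴ * M).trace.re = traceNorm M := by
  obtain ⟨U, S, -, h1, h2, h3, h4⟩ := exists_polar_traceNorm M
  exact ⟨U, h3, by rw [← h4, ← h1, ← mul_assoc, h2]⟩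

/-- A Hermitian matrix `K` of trace zero satisfies `2 tr (K P) ≤ ‖K‖₁` for all `0 ≤ P ≤ 1`. -/
theorem two_mul_re_trace_mul_le_traceNorm {K P : Matrix n n ℂ} (hK : K.IsHermitian)
    (htr : K.trace = 0) (hP : 0 ≤ P) (hP1 : P ≤ 1) :
    2 * (K * P).trace.re ≤ traceNorm K := by
  have hKsa : IsSelfAdjoint K := hK
  have habs : CFC.sqrt (Kᴴ * K) = CFC.abs K := rfl
  have h1 : K ≤ CFC.abs K := by
    rw [← sub_nonneg, CFC.abs_sub_self K hKsa]
    exact nsmul_nonneg (CFC.negPart_nonneg K) 2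
  have h2 : -K ≤ CFC.abs K := by
    rw [← sub_nonneg, sub_neg_eq_add, CFC.abs_add_self K hKsa]
    exact nsmul_nonneg (CFC.posPart_nonneg K) 2
  have e1 := re_trace_mul_le_left h1 hP
  have e2 := re_trace_mul_le_left h2 (sub_nonneg.mpr hP1)
  simp only [mul_sub, Matrix.neg_mul, mul_one, Matrix.trace_sub, Matrix.trace_neg,
    Complex.sub_re, Complex.neg_re, htr, Complex.zero_re] at e2
  rw [traceNorm, habs]
  linarith

omit [DecidableEq n] in
/-- The Cauchy–Schwarz inequality for one Kraus operator `K`, applied to a matrix `U S` in polar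
form and paired with a contraction `V`. -/
theorem two_mul_re_trace_sandwich_le {m : Type*} [Fintype m] [DecidableEq m] (K : Matrix m n ℂ)
    {U S : Matrix n n ℂ} {V : Matrix m m ℂ} (hS : 0 ≤ S) (hV : V * Vᴴ ≤ 1) :
    2 * (Vᴴ * (K * (U * S) * Kᴴ)).trace.re ≤
      (K * (U * S * Uᴴ) * Kᴴ).trace.re + (K * S * Kᴴ).trace.re := by
  have hS' := Matrix.nonneg_iff_posSemidef.mp hS
  have hSh : Sᴴ = S := hS'.isHermitian
  -- expand the square of `Vᴴ K U - K`, weighted by `S`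
  have h0 := re_trace_nonneg
    (hS'.mul_mul_conjTranspose_same (Vᴴ * K * U - K)).nonneg
  have hPos : 0 ≤ K * (U * S * Uᴴ) * Kᴴ :=
    ((hS'.mul_mul_conjTranspose_same U).mul_mul_conjTranspose_same K).nonneg
  have h1 := re_trace_mul_le_left hV hPos
  have e : (Vᴴ * K * U - K) * S * (Vᴴ * K * U - K)ᴴ =
      Vᴴ * (K * (U * S * Uᴴ) * Kᴴ) * V - Vᴴ * (K * (U * S) * Kᴴ)
        - (Vᴴ * (K * (U * S) * Kᴴ))ᴴ + K * S * Kᴴ := by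
    simp only [Matrix.conjTranspose_sub, Matrix.conjTranspose_mul,
      Matrix.conjTranspose_conjTranspose, hSh, Matrix.sub_mul, Matrix.mul_sub, Matrix.mul_assoc]
    abel
  rw [e, Matrix.trace_add, Matrix.trace_sub, Matrix.trace_sub, Complex.add_re, Complex.sub_re,
    Complex.sub_re, re_trace_conjTranspose, Matrix.trace_mul_comm _ V, ← Matrix.mul_assoc V] at h0
  rw [one_mul] at h1
  linarith

end TraceNorm

/-! ### Choi matrices and Kraus representations -/

section Choi
variable {A B : Type*} [Fintype A] [DecidableEq A]

theorem choi_apply (Λ : Matrix A A ℂ →ₗ[ℂ] Matrix B B ℂ) (b b' : B) (a a' : A) :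
    choi Λ (b, a) (b', a') = Λ (Matrix.single a a' 1) b b' := by
  simp [choi, Matrix.sum_apply, Matrix.single_apply, ite_and]

theorem apply_eq_sum_choi (Λ : Matrix A A ℂ →ₗ[ℂ] Matrix B B ℂ) (X : Matrix A A ℂ) (b b' : B) :
    Λ X b b' = ∑ a, ∑ a', choi Λ (b, a) (b', a') * X a a' := by
  conv_lhs => rw [Matrix.matrix_eq_sum_single X]
  simp only [map_sum, Matrix.sum_apply, choi_apply]
  refine Finset.sum_congr rfl fun a _ => Finset.sum_congr rfl fun a' _ => ?_
  have : Matrix.single a a' (X a a') = X a a' • Matrix.single a a' (1 : ℂ) := by simp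
  rw [this, map_smul, Matrix.smul_apply, smul_eq_mul, mul_comm]

theorem tensorId_apply (Λ : Matrix A A ℂ →ₗ[ℂ] Matrix B B ℂ) {C : Type*}
    (M : Matrix (A × C) (A × C) ℂ) (x y : B × C) :
    tensorId Λ C M x y =
      ∑ a, ∑ a', choi Λ (x.1, a) (y.1, a') * M (a, x.2) (a', y.2) :=
  apply_eq_sum_choi Λ _ _ _

theorem choi_sub (Λ Λ' : Matrix A A ℂ →ₗ[ℂ] Matrix B B ℂ) :
    choi (Λ - Λ') = choi Λ - choi Λ' := by
  ext ⟨b, a⟩ ⟨b', a'⟩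
  simp [choi_apply]

/-- The linear map with a prescribed Choi matrix (the inverse of `choi`). -/
def ofChoi (Z : Matrix (B × A) (B × A) ℂ) : Matrix A A ℂ →ₗ[ℂ] Matrix B B ℂ where
  toFun X := Matrix.of fun b b' => ∑ a, ∑ a', Z (b, a) (b', a') * X a a'
  map_add' X Y := by
    ext b b'
    simp [mul_add, Finset.sum_add_distrib]
  map_smul' c X := by
    ext b b'
    simp [Finset.mul_sum, mul_left_comm]

omit [DecidableEq A] in
theorem ofChoi_apply (Z : Matrix (B × A) (B × A) ℂ) (X : Matrix A A ℂ) (b b' : B) :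
    ofChoi Z X b b' = ∑ a, ∑ a', Z (b, a) (b', a') * X a a' := rfl

theorem choi_ofChoi (Z : Matrix (B × A) (B × A) ℂ) : choi (ofChoi Z) = Z := by
  ext ⟨b, a⟩ ⟨b', a'⟩
  simp [choi_apply, ofChoi_apply, Matrix.single_apply, ite_and]

theorem choi_injective :
    Function.Injective (choi : (Matrix A A ℂ →ₗ[ℂ] Matrix B B ℂ) → Matrix (B × A) (B × A) ℂ) := by
  intro Λ Λ' h
  refine LinearMap.ext fun X => ?_
  ext b b'
  rw [apply_eq_sum_choi, apply_eq_sum_choi, h]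

variable [Fintype B]

/-- A map with positive semidefinite Choi matrix has a **Kraus representation**, also after
tensoring with the identity of an auxiliary system. -/
theorem exists_kraus {Λ : Matrix A A ℂ →ₗ[ℂ] Matrix B B ℂ} (h : 0 ≤ choi Λ)
    (C : Type*) [Fintype C] [DecidableEq C] :
    ∃ K : B × A → Matrix (B × C) (A × C) ℂ, ∀ M : Matrix (A × C) (A × C) ℂ,
      tensorId Λ C M = ∑ k, K k * M * (K k)ᴴ := by
  classical
  obtain ⟨R, hR⟩ := CStarAlgebra.nonneg_iff_eq_star_mul_self.mp h
  refine ⟨fun k => Matrix.of (fun b a => star (R k (b, a))) ⊗ₖ 1, fun M => ?_⟩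
  ext ⟨b, c⟩ ⟨b', c'⟩
  rw [tensorId_apply, hR]
  simp only [Matrix.sum_apply, Matrix.mul_apply, Matrix.star_apply, Matrix.conjTranspose_apply,
    Fintype.sum_prod_type, Matrix.kroneckerMap_apply, Matrix.of_apply, Matrix.one_apply,
    mul_ite, mul_one, mul_zero, ite_mul, zero_mul, apply_ite (star : ℂ → ℂ), star_zero, star_star,
    Finset.sum_ite_eq, Finset.mem_univ, if_true, Finset.sum_mul]
  -- only the order of summation is left
  rw [Finset.sum_comm_cycle]
  refine Finset.sum_congr rfl fun k _ => ?_
  rw [Finset.sum_comm_cycle]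
  refine Finset.sum_congr rfl fun l _ => ?_
  rw [Finset.sum_comm]
  refine Finset.sum_congr rfl fun a _ => Finset.sum_congr rfl fun a' _ => ?_
  ring

theorem tensorId_nonneg {Λ : Matrix A A ℂ →ₗ[ℂ] Matrix B B ℂ} (h : 0 ≤ choi Λ)
    {C : Type*} [Fintype C] [DecidableEq C] {M : Matrix (A × C) (A × C) ℂ} (hM : 0 ≤ M) :
    0 ≤ tensorId Λ C M := by
  obtain ⟨K, hK⟩ := exists_kraus h C
  rw [hK]
  exact Finset.sum_nonneg fun k _ =>
    ((Matrix.nonneg_iff_posSemidef.mp hM).mul_mul_conjTranspose_same (K k)).nonneg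

end Choi

/-! ### The operator norm of Hermitian matrices -/

section OperatorNorm
open scoped Matrix.Norms.L2Operator
variable {n : Type*} [Fintype n] [DecidableEq n]

theorem operatorNorm_nonneg (T : Matrix n n ℂ) : 0 ≤ operatorNorm T := norm_nonneg _

theorem le_operatorNorm_smul_one {T : Matrix n n ℂ} (hT : T.IsHermitian) :
    T ≤ operatorNorm T • (1 : Matrix n n ℂ) := by
  have h : IsSelfAdjoint T := hT
  have := h.le_algebraMap_norm_self
  rwa [Algebra.algebraMap_eq_smul_one] at this

theorem operatorNorm_le_of_le_smul_one {T : Matrix n n ℂ} {c : ℝ} (hT : 0 ≤ T) (hc : 0 ≤ c)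
    (h : T ≤ c • (1 : Matrix n n ℂ)) : operatorNorm T ≤ c := by
  rw [← Algebra.algebraMap_eq_smul_one] at h
  exact (CStarAlgebra.norm_le_iff_le_algebraMap T hc hT).mpr h

end OperatorNorm

/-! ### Upper bounds on the diamond norm -/

section Upper
variable {A B : Type*} [Fintype B]

theorem partialTraceFst_sub (M N : Matrix (B × A) (B × A) ℂ) :
    partialTraceFst (M - N) = partialTraceFst M - partialTraceFst N := by
  ext a a'
  simp [partialTraceFst]

theorem partialTraceFst_add (M N : Matrix (B × A) (B × A) ℂ) :
    partialTraceFst (M + N) = partialTraceFst M + partialTraceFst N := by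
  ext a a'
  simp [partialTraceFst, Finset.sum_add_distrib]

theorem partialTraceFst_smul (c : ℝ) (M : Matrix (B × A) (B × A) ℂ) :
    partialTraceFst (c • M) = c • partialTraceFst M := by
  ext a a'
  simp [partialTraceFst, Finset.mul_sum]

theorem continuous_partialTraceFst :
    Continuous (partialTraceFst : Matrix (B × A) (B × A) ℂ → Matrix A A ℂ) := by
  refine continuous_matrix fun a a' => ?_
  exact continuous_finsetSum _ fun b _ => continuous_id.matrix_elem _ _

theorem partialTraceFst_nonneg {M : Matrix (B × A) (B × A) ℂ} (hM : 0 ≤ M) :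
    0 ≤ partialTraceFst M := by
  have : partialTraceFst M = ∑ b, M.submatrix (fun a => (b, a)) (fun a => (b, a)) := by
    ext a a'
    simp [partialTraceFst, Matrix.sum_apply]
  rw [this]
  exact Finset.sum_nonneg fun b _ => ((Matrix.nonneg_iff_posSemidef.mp hM).submatrix _).nonneg

variable [Fintype A]

theorem trace_partialTraceFst (M : Matrix (B × A) (B × A) ℂ) :
    (partialTraceFst M).trace = M.trace := by
  simp only [Matrix.trace, Matrix.diag_apply, partialTraceFst, Matrix.of_apply,
    Fintype.sum_prod_type]
  rw [Finset.sum_comm]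

/-- The partial trace is adjoint to `ρ ↦ 1 ⊗ ρ`. -/
theorem trace_mul_one_kronecker [DecidableEq B] (M : Matrix (B × A) (B × A) ℂ)
    (ρ : Matrix A A ℂ) :
    (M * ((1 : Matrix B B ℂ) ⊗ₖ ρ)).trace = (partialTraceFst M * ρ).trace := by
  simp only [Matrix.trace, Matrix.diag_apply, Matrix.mul_apply, partialTraceFst, Matrix.of_apply,
    Fintype.sum_prod_type, Matrix.kroneckerMap_apply, Matrix.one_apply, ite_mul, one_mul, zero_mul,
    mul_ite, mul_zero, Finset.sum_mul]
  simp only [Finset.sum_comm (s := (Finset.univ : Finset A)) (t := (Finset.univ : Finset B))]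
  refine Finset.sum_congr rfl fun b _ => ?_
  rw [Finset.sum_eq_single b (fun b' _ hb => by simp [hb]) (by simp)]
  simp

variable [DecidableEq A]

/-- A completely positive map scales the trace of positive matrices at most by the operator norm
of the partial trace of its Choi matrix. -/
theorem re_trace_tensorId_le {Λ : Matrix A A ℂ →ₗ[ℂ] Matrix B B ℂ} (h : 0 ≤ choi Λ)
    {C : Type*} [Fintype C] {P : Matrix (A × C) (A × C) ℂ} (hP : 0 ≤ P) :
    (tensorId Λ C P).trace.re ≤ operatorNorm (partialTraceFst (choi Λ)) * P.trace.re := by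
  set T := partialTraceFst (choi Λ) with hT
  have hTh : T.IsHermitian :=
    (Matrix.nonneg_iff_posSemidef.mp (partialTraceFst_nonneg h)).isHermitian
  -- the transpose of the partial trace of `P` over `C`
  let Q : Matrix A A ℂ := ∑ c, (P.submatrix (fun a => (a, c)) (fun a => (a, c)))ᵀ
  have hQ : 0 ≤ Q := Finset.sum_nonneg fun c _ =>
    ((Matrix.nonneg_iff_posSemidef.mp hP).submatrix _).transpose.nonneg
  have hQtr : Q.trace = P.trace := by
    simp only [Q, Matrix.trace, Matrix.diag_apply, Matrix.sum_apply, Matrix.transpose_apply,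
      Matrix.submatrix_apply, Fintype.sum_prod_type]
  have key : (tensorId Λ C P).trace = (T * Q).trace := by
    simp only [Q, hT, Matrix.trace, Matrix.diag_apply, Matrix.sum_apply, Matrix.mul_apply,
      Matrix.transpose_apply, Matrix.submatrix_apply, Fintype.sum_prod_type, tensorId_apply,
      partialTraceFst, Matrix.of_apply, Finset.sum_mul, Finset.mul_sum]
    rw [Finset.sum_comm]
    conv_rhs => rw [Finset.sum_comm]
    refine Finset.sum_congr rfl fun c _ => ?_
    conv_rhs => rw [Finset.sum_comm_cycle]
  have := re_trace_mul_le_left (le_operatorNorm_smul_one hTh) hQ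
  rw [key, ← hQtr]
  simpa [Matrix.trace_smul] using this

/-- For a completely positive `Λ`, the pairing of `(Λ ⊗ 1) M` with a contraction is controlled by
the operator norm of the partial trace of the Choi matrix: insert the polar decomposition of `M`
into the Kraus representation and apply the Cauchy–Schwarz inequality. -/
theorem re_trace_mul_tensorId_le [DecidableEq B] {Λ : Matrix A A ℂ →ₗ[ℂ] Matrix B B ℂ}
    (h : 0 ≤ choi Λ) {C : Type*} [Fintype C] [DecidableEq C] (M : Matrix (A × C) (A × C) ℂ)
    {V : Matrix (B × C) (B × C) ℂ} (hV : V * Vᴴ ≤ 1) :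
    (Vᴴ * tensorId Λ C M).trace.re ≤
      operatorNorm (partialTraceFst (choi Λ)) * traceNorm M := by
  obtain ⟨U, S, hS, rfl, hUS, -, htr⟩ := exists_polar_traceNorm M
  rw [← htr]
  obtain ⟨K, hK⟩ := exists_kraus h C
  have hUSU : 0 ≤ U * S * Uᴴ :=
    ((Matrix.nonneg_iff_posSemidef.mp hS).mul_mul_conjTranspose_same U).nonneg
  have h1 := re_trace_tensorId_le h hUSU
  have h2 := re_trace_tensorId_le h hS
  rw [Matrix.trace_mul_comm, ← mul_assoc, hUS] at h1
  have h3 : 2 * (Vᴴ * tensorId Λ C (U * S)).trace.re ≤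
      (tensorId Λ C (U * S * Uᴴ)).trace.re + (tensorId Λ C S).trace.re := by
    simp only [hK, Finset.mul_sum, Matrix.trace_sum, Complex.re_sum, ← Finset.sum_add_distrib]
    exact Finset.sum_le_sum fun k _ => two_mul_re_trace_sandwich_le (K k) hS hV
  linarith

omit [Fintype A] [DecidableEq A] [Fintype B] in
theorem tensorId_sub (Λ Λ' : Matrix A A ℂ →ₗ[ℂ] Matrix B B ℂ) (C : Type*)
    (M : Matrix (A × C) (A × C) ℂ) :
    tensorId (Λ - Λ') C M = tensorId Λ C M - tensorId Λ' C M := rfl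

/-- If `Z` dominates the Choi matrix of `Λ` and `0`, then `Λ` is the difference of the completely
positive maps with Choi matrices `Z` and `Z - J(Λ)`; when `tr_B J(Λ) = 0`, both scale the trace
norm at most by `‖tr_B Z‖`. -/
theorem traceNorm_tensorId_le [DecidableEq B] {Λ : Matrix A A ℂ →ₗ[ℂ] Matrix B B ℂ}
    {Z : Matrix (B × A) (B × A) ℂ} (hZ : 0 ≤ Z) (hΛ : choi Λ ≤ Z)
    (htr : partialTraceFst (choi Λ) = 0) {C : Type*} [Fintype C] [DecidableEq C]
    (M : Matrix (A × C) (A × C) ℂ) :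
    traceNorm (tensorId Λ C M) ≤ 2 * operatorNorm (partialTraceFst Z) * traceNorm M := by
  have hΛ' : Λ = ofChoi Z - ofChoi (Z - choi Λ) := by
    apply choi_injective
    rw [choi_sub, choi_ofChoi, choi_ofChoi, sub_sub_cancel]
  obtain ⟨V, hV, hVM⟩ := exists_re_trace_mul_eq_traceNorm (tensorId Λ C M)
  have h1 := re_trace_mul_tensorId_le (Λ := ofChoi Z) (by rwa [choi_ofChoi]) M hV
  have h2 := re_trace_mul_tensorId_le (Λ := ofChoi (Z - choi Λ))
    (by rwa [choi_ofChoi, sub_nonneg]) M (V := -V) (by simpa using hV)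
  rw [choi_ofChoi] at h1
  rw [choi_ofChoi, partialTraceFst_sub, htr, sub_zero, Matrix.conjTranspose_neg, Matrix.neg_mul,
    Matrix.trace_neg, Complex.neg_re] at h2
  rw [← hVM, hΛ', tensorId_sub, Matrix.mul_sub, Matrix.trace_sub, Complex.sub_re]
  linarith

variable [DecidableEq B] {Λ : Matrix A A ℂ →ₗ[ℂ] Matrix B B ℂ}
    {Z : Matrix (B × A) (B × A) ℂ}

theorem inducedTraceNorm_le {c : ℝ} (hc : ∀ X, traceNorm (Λ X) ≤ c * traceNorm X) (hc0 : 0 ≤ c) :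
    inducedTraceNorm Λ ≤ c := by
  refine csSup_le ⟨_, 0, by simp [traceNorm_zero], rfl⟩ ?_
  rintro r ⟨X, hX, rfl⟩
  exact (hc X).trans (mul_le_of_le_one_right hc0 hX)

theorem le_inducedTraceNorm {c : ℝ} (hc : ∀ X, traceNorm (Λ X) ≤ c * traceNorm X) (hc0 : 0 ≤ c)
    {X : Matrix A A ℂ} (hX : traceNorm X ≤ 1) : traceNorm (Λ X) ≤ inducedTraceNorm Λ := by
  refine le_csSup ⟨c, ?_⟩ ⟨X, hX, rfl⟩
  rintro r ⟨X, hX, rfl⟩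
  exact (hc X).trans (mul_le_of_le_one_right hc0 hX)

theorem diamondNorm_le (hZ : 0 ≤ Z) (hΛ : choi Λ ≤ Z) (htr : partialTraceFst (choi Λ) = 0) :
    diamondNorm Λ ≤ 2 * operatorNorm (partialTraceFst Z) :=
  ciSup_le fun _ => inducedTraceNorm_le (traceNorm_tensorId_le hZ hΛ htr)
    (mul_nonneg zero_le_two (operatorNorm_nonneg _))

/-- The suprema in the definition of the diamond norm are bounded as soon as the Choi matrix is
dominated by a positive semidefinite matrix. -/
theorem traceNorm_tensorId_le_diamondNorm (hZ : 0 ≤ Z) (hΛ : choi Λ ≤ Z)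
    (htr : partialTraceFst (choi Λ) = 0) {k : ℕ} {M : Matrix (A × Fin k) (A × Fin k) ℂ}
    (hM : traceNorm M ≤ 1) : traceNorm (tensorId Λ (Fin k) M) ≤ diamondNorm Λ := by
  have h0 : 0 ≤ 2 * operatorNorm (partialTraceFst Z) :=
    mul_nonneg zero_le_two (operatorNorm_nonneg _)
  refine (le_inducedTraceNorm (traceNorm_tensorId_le hZ hΛ htr) h0 hM).trans ?_
  refine le_ciSup (f := fun k : ℕ => inducedTraceNorm (tensorId Λ (Fin k)))
    ⟨2 * operatorNorm (partialTraceFst Z), ?_⟩ k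
  rintro r ⟨j, rfl⟩
  exact inducedTraceNorm_le (traceNorm_tensorId_le hZ hΛ htr) h0

end Upper

/-! ### Lower bounds on the diamond norm -/

section Lower
variable {A B : Type*} [Fintype A] [DecidableEq A] [Fintype B] [DecidableEq B]
  {Λ : Matrix A A ℂ →ₗ[ℂ] Matrix B B ℂ} {X Z : Matrix (B × A) (B × A) ℂ} {ρ : Matrix A A ℂ}

omit [DecidableEq A] in
theorem one_kronecker_mono {σ : Matrix A A ℂ} (h : ρ ≤ σ) :
    (1 : Matrix B B ℂ) ⊗ₖ ρ ≤ (1 : Matrix B B ℂ) ⊗ₖ σ := by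
  have e : (1 : Matrix B B ℂ) ⊗ₖ σ - (1 : Matrix B B ℂ) ⊗ₖ ρ = (1 : Matrix B B ℂ) ⊗ₖ (σ - ρ) := by
    ext ⟨b, a⟩ ⟨b', a'⟩
    simp [Matrix.kroneckerMap_apply, mul_sub]
  rw [Matrix.le_iff, e]
  exact Matrix.PosSemidef.one.kronecker (Matrix.le_iff.mp h)

/-- The input state that turns `X` into a test `0 ≤ P ≤ 1` on the output of `Λ ⊗ 1` is the
canonical purification of `ρ`. -/
theorem two_mul_re_trace_choi_mul_le_diamondNorm_of_posDef (hH : (choi Λ).IsHermitian)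
    (hZ : 0 ≤ Z) (hΛ : choi Λ ≤ Z) (htr : partialTraceFst (choi Λ) = 0) (hX : 0 ≤ X)
    (hXρ : X ≤ (1 : Matrix B B ℂ) ⊗ₖ ρ) (hρ : ρ.PosDef) (hρ1 : ρ.trace = 1) :
    2 * (choi Λ * X).trace.re ≤ diamondNorm Λ := by
  set H := choi Λ with hHdef
  set r := CFC.sqrt ρ with hr
  have hrr : r * r = ρ := CFC.sqrt_mul_sqrt_self ρ hρ.posSemidef.nonneg
  have hrh : rᴴ = r := (Matrix.nonneg_iff_posSemidef.mp (CFC.sqrt_nonneg ρ)).isHermitian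
  have hstar : ∀ i j, star (r i j) = r j i := fun i j => by
    conv_rhs => rw [← hrh, Matrix.conjTranspose_apply]
  have hrdet : IsUnit r.det := by
    have : IsUnit (r * r).det := by rw [hrr]; exact (Matrix.isUnit_iff_isUnit_det _).mp hρ.isUnit
    rw [Matrix.det_mul] at this
    exact isUnit_of_mul_isUnit_left this
  set R := (1 : Matrix B B ℂ) ⊗ₖ r with hR
  set R' := (1 : Matrix B B ℂ) ⊗ₖ r⁻¹ with hR'
  have hRR' : R * R' = 1 := by
    rw [hR, hR', ← Matrix.mul_kronecker_mul, Matrix.mul_nonsing_inv _ hrdet, one_mul,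
      Matrix.one_kronecker_one]
  have hR'R : R' * R = 1 := by
    rw [hR, hR', ← Matrix.mul_kronecker_mul, Matrix.nonsing_inv_mul _ hrdet, one_mul,
      Matrix.one_kronecker_one]
  have hRR : R * R = (1 : Matrix B B ℂ) ⊗ₖ ρ := by
    rw [hR, ← Matrix.mul_kronecker_mul, one_mul, hrr]
  have hRh : Rᴴ = R := by
    rw [hR, Matrix.conjTranspose_kronecker, hrh, Matrix.conjTranspose_one]
  have hR'h : R'ᴴ = R' := by
    rw [hR', Matrix.conjTranspose_kronecker, Matrix.conjTranspose_nonsing_inv, hrh,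
      Matrix.conjTranspose_one]
  let e := Fintype.equivFin A
  let f : B × Fin (Fintype.card A) ≃ B × A := (Equiv.refl B).prodCongr e.symm
  have htrf : ∀ N : Matrix (B × A) (B × A) ℂ, (N.submatrix f f).trace = N.trace :=
    fun N => Equiv.sum_comp f fun i => N i i
  let ψ : A × Fin (Fintype.card A) → ℂ := fun x => r (e.symm x.2) x.1
  let M := Matrix.vecMulVec ψ (star ψ)
  have hMtr : M.trace = 1 := by
    rw [← hρ1, ← hrr, Matrix.trace_vecMulVec]
    simp only [ψ, dotProduct, Fintype.sum_prod_type, Matrix.trace, Matrix.diag_apply,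
      Matrix.mul_apply, Pi.star_apply, hstar]
    refine Finset.sum_congr rfl fun a _ => ?_
    rw [← Equiv.sum_comp e.symm]
    exact Finset.sum_congr rfl fun i _ => mul_comm _ _
  have hMn : traceNorm M ≤ 1 := by
    rw [traceNorm_eq_re_trace_of_nonneg (Matrix.posSemidef_vecMulVec_self_star ψ).nonneg, hMtr]
    simp
  have hK : tensorId Λ (Fin (Fintype.card A)) M = (R * H * R).submatrix f f := by
    ext ⟨b, c⟩ ⟨b', c'⟩
    simp only [tensorId_apply, M, ψ, Matrix.vecMulVec_apply, Pi.star_apply, hstar, f, hR,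
      Matrix.submatrix_apply, Equiv.prodCongr_apply, Prod.map_apply, Equiv.refl_apply,
      Matrix.mul_apply, Matrix.kroneckerMap_apply, Fintype.sum_prod_type, Matrix.one_apply,
      ite_mul, mul_ite, one_mul, mul_zero, zero_mul, Finset.sum_ite_irrel,
      Finset.sum_const_zero, Finset.sum_ite_eq, Finset.sum_ite_eq', Finset.mem_univ, if_true,
      Finset.sum_mul]
    rw [Finset.sum_comm]
    refine Finset.sum_congr rfl fun a _ => Finset.sum_congr rfl fun a' _ => ?_
    ring
  have hP0 : 0 ≤ R' * X * R' := by
    have := (Matrix.nonneg_iff_posSemidef.mp hX).mul_mul_conjTranspose_same R'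
    rw [hR'h] at this
    exact this.nonneg
  have hP1 : R' * X * R' ≤ 1 := by
    have := (Matrix.le_iff.mp hXρ).mul_mul_conjTranspose_same R'
    rw [hR'h, ← hRR, Matrix.mul_sub, Matrix.sub_mul, ← Matrix.mul_assoc R', hR'R, one_mul,
      hRR'] at this
    exact Matrix.le_iff.mpr this
  have hKh : ((R * H * R).submatrix f f).IsHermitian := by
    refine Matrix.IsHermitian.submatrix ?_ f
    rw [Matrix.IsHermitian, Matrix.conjTranspose_mul, Matrix.conjTranspose_mul, hRh, hH,
      Matrix.mul_assoc]
  have hKtr : ((R * H * R).submatrix f f).trace = 0 := by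
    rw [htrf, Matrix.trace_mul_comm, ← Matrix.mul_assoc, hRR,
      Matrix.trace_mul_comm, trace_mul_one_kronecker, htr, Matrix.zero_mul, Matrix.trace_zero]
  have h := two_mul_re_trace_mul_le_traceNorm hKh hKtr
    (P := (R' * X * R').submatrix f f)
    ((Matrix.nonneg_iff_posSemidef.mp hP0).submatrix f).nonneg
    (by
      rw [Matrix.le_iff, ← Matrix.submatrix_one_equiv f]
      exact (Matrix.le_iff.mp hP1).submatrix f)
  rw [Matrix.submatrix_mul_equiv, htrf] at h
  have hKP : (R * H * R * (R' * X * R')).trace = (H * X).trace := by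
    have : R * H * R * (R' * X * R') = R * (H * (R * R') * X * R') := by
      simp only [Matrix.mul_assoc]
    rw [this, Matrix.trace_mul_comm, hRR', Matrix.mul_assoc, hR'R, mul_one, mul_one]
  rw [hKP, ← hK] at h
  exact h.trans (traceNorm_tensorId_le_diamondNorm hZ hΛ htr hMn)

/-- The diamond norm of `Λ` dominates the value of every dual test `0 ≤ X ≤ 1 ⊗ ρ`. -/
theorem two_mul_re_trace_choi_mul_le_diamondNorm (hH : (choi Λ).IsHermitian)
    (hZ : 0 ≤ Z) (hΛ : choi Λ ≤ Z) (htr : partialTraceFst (choi Λ) = 0) (hX : 0 ≤ X)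
    (hXρ : X ≤ (1 : Matrix B B ℂ) ⊗ₖ ρ) (hρ : 0 ≤ ρ) (hρ1 : ρ.trace = 1) :
    2 * (choi Λ * X).trace.re ≤ diamondNorm Λ := by
  -- replace `ρ` by the positive definite state `(ρ + ε) / (1 + ε dim A)` and let `ε` tend to zero
  have key : ∀ ε : ℝ, 0 < ε → 2 * (choi Λ * X).trace.re ≤
      (1 + ε * Fintype.card A) * diamondNorm Λ := by
    intro ε hε
    have hc : 0 < 1 + ε * Fintype.card A := by positivity
    set c : ℝ := 1 + ε * Fintype.card A with hcdef
    have hσ : (c⁻¹ • (ρ + ε • (1 : Matrix A A ℂ))).PosDef :=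
      (((Matrix.PosDef.one.smul hε).posSemidef_add (Matrix.nonneg_iff_posSemidef.mp hρ))).smul
        (inv_pos.mpr hc)
    have hσ1 : (c⁻¹ • (ρ + ε • (1 : Matrix A A ℂ))).trace = 1 := by
      rw [Matrix.trace_smul, Matrix.trace_add, Matrix.trace_smul, hρ1, Matrix.trace_one]
      have : (1 : ℂ) + ε • (Fintype.card A : ℂ) = c := by simp [hcdef]
      rw [this, Complex.real_smul, ← Complex.ofReal_mul, inv_mul_cancel₀ hc.ne', Complex.ofReal_one]
    have hle : c⁻¹ • X ≤ (1 : Matrix B B ℂ) ⊗ₖ (c⁻¹ • (ρ + ε • (1 : Matrix A A ℂ))) := by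
      rw [Matrix.kronecker_smul]
      refine smul_le_smul_of_nonneg_left (hXρ.trans (one_kronecker_mono ?_)) (inv_pos.mpr hc).le
      exact le_add_of_nonneg_right ((Matrix.PosSemidef.one.smul hε.le).nonneg)
    have := two_mul_re_trace_choi_mul_le_diamondNorm_of_posDef hH hZ hΛ htr
      (smul_nonneg (inv_pos.mpr hc).le hX) hle hσ hσ1
    rw [Matrix.mul_smul, Matrix.trace_smul, Complex.smul_re, smul_eq_mul, mul_left_comm,
      inv_mul_le_iff₀ hc] at this
    exact this
  have hlim : Filter.Tendsto (fun ε : ℝ => (1 + ε * Fintype.card A) * diamondNorm Λ)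
      (nhdsWithin 0 (Set.Ioi 0)) (nhds ((1 + 0 * Fintype.card A) * diamondNorm Λ)) :=
    ((by fun_prop : Continuous fun ε : ℝ => (1 + ε * Fintype.card A) * diamondNorm Λ).tendsto
      0).mono_left nhdsWithin_le_nhds
  have := ge_of_tendsto hlim (Filter.eventually_of_mem self_mem_nhdsWithin key)
  simpa using this

end Lower

/-! ### Detection-incoherent operations -/

section Operations
variable {A B : Type*} [Fintype A] [DecidableEq A]
  {Θ : Matrix A A ℂ →ₗ[ℂ] Matrix B B ℂ} {W : Matrix (B × A) (B × A) ℂ}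

theorem dephasing_apply {n : Type*} [DecidableEq n] (X : Matrix n n ℂ) (i j : n) :
    dephasing n X i j = if i = j then X i j else 0 := by
  by_cases h : i = j
  · subst h; exact (Matrix.diagonal_apply_eq _ _).trans (if_pos rfl).symm
  · exact (Matrix.diagonal_apply_ne _ h).trans (if_neg h).symm

theorem choi_dephasing_comp_apply [DecidableEq B] (b b' : B) (a a' : A) :
    choi (dephasing B ∘ₗ Θ) (b, a) (b', a') = if b = b' then choi Θ (b, a) (b', a') else 0 := by
  simp [choi_apply, dephasing_apply]

variable [Fintype B]

theorem IsQuantumOperation.choi_nonneg (h : IsQuantumOperation Θ) : 0 ≤ choi Θ := by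
  let e := Fintype.equivFin A
  -- the (unnormalized) maximally entangled vector
  let ω : A × Fin (Fintype.card A) → ℂ := fun x => if e x.1 = x.2 then 1 else 0
  have h1 := (h.completelyPositive _ _ (Matrix.posSemidef_vecMulVec_self_star ω)).submatrix
    (fun x : B × A => (x.1, e x.2))
  convert h1.nonneg using 1
  ext ⟨b, a⟩ ⟨b', a'⟩
  simp [tensorId_apply, ω, Matrix.vecMulVec_apply, apply_ite (star : ℂ → ℂ)]

variable [DecidableEq B]

theorem choi_dephasing_comp_nonneg (h : 0 ≤ choi Θ) : 0 ≤ choi (dephasing B ∘ₗ Θ) := by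
  -- the dephasing of `B` acts on the Choi matrix as a Schur multiplier
  have h1 := (Matrix.nonneg_iff_posSemidef.mp h).hadamard
    ((Matrix.PosSemidef.one (n := B) (R := ℂ)).kronecker
      (Matrix.posSemidef_vecMulVec_self_star (1 : A → ℂ)))
  convert h1.nonneg using 1
  ext ⟨b, a⟩ ⟨b', a'⟩
  simp [choi_dephasing_comp_apply, Matrix.one_apply]

theorem IsQuantumOperation.choi_dephasing_comp_nonneg (h : IsQuantumOperation Θ) :
    0 ≤ choi (dephasing B ∘ₗ Θ) :=
  CoherenceSDP.choi_dephasing_comp_nonneg h.choi_nonneg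

theorem IsQuantumOperation.partialTraceFst_choi (h : IsQuantumOperation Θ) :
    partialTraceFst (choi (dephasing B ∘ₗ Θ)) = 1 := by
  ext a a'
  have := h.tracePreserving (Matrix.single a a' 1)
  simp only [Matrix.trace, Matrix.diag_apply] at this
  simp only [partialTraceFst, Matrix.of_apply, choi_dephasing_comp_apply, if_true]
  simp only [choi_apply, this]
  simp [Matrix.single_apply, Matrix.one_apply, ite_and, eq_comm]

theorem dephasing_choi_of_mem_detectionIncoherent (h : Θ ∈ detectionIncoherent A B) :
    choi (dephasing B ∘ₗ Θ) - dephasing (B × A) (choi (dephasing B ∘ₗ Θ)) = 0 := by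
  rw [sub_eq_zero]
  ext ⟨b, a⟩ ⟨b', a'⟩
  rw [dephasing_apply]
  split_ifs with hab
  · rfl
  by_cases hb : b = b'
  · have ha : a ≠ a' := fun ha => hab (by rw [hb, ha])
    rw [h.2, choi_apply]
    have : dephasing A (Matrix.single a a' (1 : ℂ)) = 0 := by
      ext i j
      rw [dephasing_apply]
      split_ifs with hij
      · subst hij
        exact Matrix.single_apply_of_ne _ _ _ _ _ (fun ⟨h1, h2⟩ => ha (h1.trans h2.symm))
      · rfl
    simp [this]
  · rw [choi_dephasing_comp_apply, if_neg hb]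

omit [Fintype B] in
theorem dephasing_comp_ofChoi (hd : W - dephasing (B × A) W = 0) :
    dephasing B ∘ₗ ofChoi W = ofChoi W := by
  rw [sub_eq_zero] at hd
  apply choi_injective
  ext ⟨b, a⟩ ⟨b', a'⟩
  rw [choi_dephasing_comp_apply, choi_ofChoi]
  split_ifs with hb
  · rfl
  · rw [hd, dephasing_apply, if_neg (by simp [hb])]

/-- A diagonal Choi matrix is that of a classical channel, which is detection incoherent. -/
theorem ofChoi_mem_detectionIncoherent (hd : W - dephasing (B × A) W = 0) (hW : 0 ≤ W)
    (htr : partialTraceFst W = 1) : ofChoi W ∈ detectionIncoherent A B := by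
  refine ⟨⟨fun k M hM => ?_, fun X => ?_⟩, ?_⟩
  · exact Matrix.nonneg_iff_posSemidef.mp (tensorId_nonneg (by rwa [choi_ofChoi]) hM.nonneg)
  · have h1 : ∀ a a', ∑ b, W (b, a) (b, a') = (1 : Matrix A A ℂ) a a' := fun a a' => by
      rw [← htr]; rfl
    simp only [Matrix.trace, Matrix.diag_apply, ofChoi_apply]
    rw [← Finset.sum_comm_cycle]
    simp [← Finset.sum_mul, h1, Matrix.one_apply]
  · have h2 := dephasing_comp_ofChoi hd
    rw [← LinearMap.comp_assoc, h2]
    rw [sub_eq_zero] at hd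
    refine LinearMap.ext fun X => ?_
    ext b b'
    rw [LinearMap.comp_apply, ofChoi_apply, ofChoi_apply]
    refine Finset.sum_congr rfl fun a _ => Finset.sum_congr rfl fun a' _ => ?_
    rw [dephasing_apply]
    split_ifs with ha
    · rfl
    · rw [hd, dephasing_apply, if_neg (by simp [ha]), zero_mul, zero_mul]

end Operations

/-! ### Density matrices and spectral projections -/

section States
open scoped Matrix.Norms.L2Operator
variable {n : Type*} [Fintype n] [DecidableEq n]

theorem le_re_trace_smul_one {M : Matrix n n ℂ} (hM : 0 ≤ M) :
    M ≤ M.trace.re • (1 : Matrix n n ℂ) := by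
  have hM' := Matrix.nonneg_iff_posSemidef.mp hM
  have hsa : IsSelfAdjoint M := hM'.isHermitian
  rw [← Algebra.algebraMap_eq_smul_one]
  refine le_algebraMap_of_spectrum_le fun x hx => ?_
  rw [hM'.isHermitian.spectrum_real_eq_range_eigenvalues] at hx
  obtain ⟨i, rfl⟩ := hx
  rw [hM'.isHermitian.trace_eq_sum_eigenvalues, Complex.re_sum]
  exact Finset.single_le_sum (f := hM'.isHermitian.eigenvalues)
    (fun j _ => hM'.eigenvalues_nonneg j) (Finset.mem_univ i)

theorem isCompact_setOf_nonneg_re_trace_le (R : ℝ) :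
    IsCompact {M : Matrix n n ℂ | 0 ≤ M ∧ M.trace.re ≤ R} := by
  refine Metric.isCompact_of_isClosed_isBounded ?_ ?_
  · exact (isClosed_Ici (a := (0 : Matrix n n ℂ))).inter
      (isClosed_le (f := fun M : Matrix n n ℂ => M.trace.re) (by fun_prop) continuous_const)
  · refine (Metric.isBounded_closedBall (x := (0 : Matrix n n ℂ)) (r := R)).subset ?_
    rintro M ⟨hM, hR⟩
    rw [mem_closedBall_zero_iff]
    exact (operatorNorm_le_of_le_smul_one hM (re_trace_nonneg hM)
      (le_re_trace_smul_one hM)).trans hR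

omit [DecidableEq n] in
theorem re_trace_smul (c : ℝ) (M : Matrix n n ℂ) : (c • M).trace.re = c * M.trace.re := by
  rw [Matrix.trace_smul, Complex.smul_re, smul_eq_mul]

variable (n) in
/-- The density matrices of a system. -/
def states : Set (Matrix n n ℂ) := {ρ | 0 ≤ ρ ∧ ρ.trace = 1}

variable (n) in
theorem convex_states : Convex ℝ (states n) := by
  rintro ρ ⟨h1, h2⟩ σ ⟨h3, h4⟩ a b ha hb hab
  refine ⟨add_nonneg (smul_nonneg ha h1) (smul_nonneg hb h3), ?_⟩
  rw [Matrix.trace_add, Matrix.trace_smul, Matrix.trace_smul, h2, h4, ← add_smul, hab, one_smul]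

variable (n) in
theorem isCompact_states : IsCompact (states n) := by
  refine (isCompact_setOf_nonneg_re_trace_le 1).of_isClosed_subset ?_ ?_
  · exact (isClosed_Ici (a := (0 : Matrix n n ℂ))).inter
      (isClosed_eq (by fun_prop) continuous_const)
  · rintro ρ ⟨h1, h2⟩
    exact ⟨h1, by simp [h2]⟩

variable (n) in
theorem isCompact_Icc_zero_one : IsCompact (Set.Icc (0 : Matrix n n ℂ) 1) := by
  refine (isCompact_setOf_nonneg_re_trace_le (Fintype.card n)).of_isClosed_subset isClosed_Icc ?_
  rintro X ⟨h0, h1⟩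
  refine ⟨h0, ?_⟩
  have := re_trace_nonneg (sub_nonneg.mpr h1)
  simpa [Matrix.trace_sub] using this

theorem le_one_of_mem_states {ρ : Matrix n n ℂ} (hρ : ρ ∈ states n) : ρ ≤ 1 := by
  simpa [hρ.2] using le_re_trace_smul_one hρ.1

theorem inv_card_smul_one_mem_states [Nonempty n] :
    (Fintype.card n : ℝ)⁻¹ • (1 : Matrix n n ℂ) ∈ states n := by
  refine ⟨smul_nonneg (by positivity) zero_le_one, ?_⟩
  rw [Matrix.trace_smul, Matrix.trace_one, Complex.real_smul]
  have : (Fintype.card n : ℂ) ≠ 0 := Nat.cast_ne_zero.mpr Fintype.card_ne_zero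
  push_cast
  exact inv_mul_cancel₀ this

theorem operatorNorm_le_of_forall_states [Nonempty n] {T : Matrix n n ℂ} (hT : 0 ≤ T) {c : ℝ}
    (h : ∀ ρ ∈ states n, (T * ρ).trace.re ≤ c) : operatorNorm T ≤ c := by
  have hc : 0 ≤ c := (re_trace_mul_nonneg hT inv_card_smul_one_mem_states.1).trans
    (h _ inv_card_smul_one_mem_states)
  refine operatorNorm_le_of_le_smul_one hT hc ?_
  have hTh : T.IsHermitian := (Matrix.nonneg_iff_posSemidef.mp hT).isHermitian
  rw [← sub_nonneg]
  refine nonneg_of_re_trace_mul_nonneg (by simp [Matrix.IsHermitian, hTh.eq]) fun Z hZ => ?_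
  rw [Matrix.mul_sub, Matrix.mul_smul, mul_one, Matrix.trace_sub, Complex.sub_re, re_trace_smul,
    sub_nonneg]
  rcases (re_trace_nonneg hZ).eq_or_lt with h0 | h0
  · have hZ' := Matrix.nonneg_iff_posSemidef.mp hZ
    have : Z = 0 := hZ'.trace_eq_zero_iff.mp
      (Complex.ext h0.symm (Complex.le_def.mp hZ'.trace_nonneg).2.symm)
    simp [this]
  · have hZ' := Matrix.nonneg_iff_posSemidef.mp hZ
    have htr : Z.trace = (Z.trace.re : ℂ) :=
      Complex.ext rfl (Complex.le_def.mp hZ'.trace_nonneg).2.symm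
    have h1 := h (Z.trace.re⁻¹ • Z) ⟨smul_nonneg (inv_pos.mpr h0).le hZ, by
      rw [Matrix.trace_smul, Complex.real_smul]
      conv_lhs => rw [htr]
      rw [Complex.ofReal_re, ← Complex.ofReal_mul, inv_mul_cancel₀ h0.ne', Complex.ofReal_one]⟩
    rw [Matrix.mul_smul, re_trace_smul, inv_mul_le_iff₀ h0, Matrix.trace_mul_comm] at h1
    linarith

/-- The positive part `N` of a Hermitian matrix `D`, together with a spectral projection `P` that
cuts it out. -/
theorem exists_posPart {D : Matrix n n ℂ} (hD : D.IsHermitian) :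
    ∃ P N : Matrix n n ℂ, 0 ≤ P ∧ P ≤ 1 ∧ 0 ≤ N ∧ D ≤ N ∧ D * P = N := by
  have hsa : IsSelfAdjoint D := hD
  have hfin : (spectrum ℝ D).Finite := Matrix.finite_real_spectrum
  have hc : ∀ f : ℝ → ℝ, ContinuousOn f (spectrum ℝ D) := fun f => hfin.continuousOn f
  have hDid : cfc (fun x : ℝ => x) D = D := cfc_id' ℝ D
  refine ⟨cfc (fun x : ℝ => if 0 < x then 1 else 0) D, cfc (fun x : ℝ => max x 0) D,
    cfc_nonneg fun x _ => ?_, cfc_le_one _ _ fun x _ => ?_, cfc_nonneg fun x _ => le_max_right _ _,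
    ?_, ?_⟩
  · split_ifs <;> norm_num
  · split_ifs <;> norm_num
  · conv_lhs => rw [← hDid]
    exact cfc_mono (fun x _ => le_max_left _ _) (hc _) (hc _)
  · calc D * cfc (fun x : ℝ => if 0 < x then 1 else 0) D
        = cfc (fun x : ℝ => x) D * cfc (fun x : ℝ => if 0 < x then 1 else 0) D := by rw [hDid]
      _ = cfc (fun x : ℝ => x * if 0 < x then 1 else 0) D := (cfc_mul _ _ D (hc _) (hc _)).symm
      _ = _ := by
        congr 1
        funext x
        split_ifs with h
        · rw [mul_one, max_eq_left h.le]
        · rw [mul_zero, max_eq_right (not_lt.mp h)]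

end States

/-! ### A saddle point of the Lagrangian -/

section Minimax
open scoped Matrix.Norms.L2Operator
theorem continuous_dephasing {n : Type*} [DecidableEq n] :
    Continuous (dephasing n : Matrix n n ℂ → Matrix n n ℂ) :=
  Continuous.matrix_diagonal (Continuous.matrix_diag continuous_id)

variable (A B : Type*) [Fintype A] [DecidableEq A] [Fintype B] [DecidableEq B]

/-- The diagonal Choi matrices of classical channels from `A` to `B`. -/
def classicalChoi : Set (Matrix (B × A) (B × A) ℂ) :=
  {W | 0 ≤ W ∧ W - dephasing (B × A) W = 0 ∧ partialTraceFst W = 1}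

theorem convex_classicalChoi : Convex ℝ (classicalChoi A B) := by
  rintro V ⟨h1, h2, h3⟩ W ⟨h4, h5, h6⟩ a b ha hb hab
  refine ⟨add_nonneg (smul_nonneg ha h1) (smul_nonneg hb h4), ?_, ?_⟩
  · rw [sub_eq_zero] at h2 h5 ⊢
    rw [map_add, LinearMap.map_smul_of_tower, LinearMap.map_smul_of_tower, ← h2, ← h5]
  · rw [partialTraceFst_add, partialTraceFst_smul, partialTraceFst_smul, h3, h6, ← add_smul, hab,
      one_smul]

theorem isCompact_classicalChoi : IsCompact (classicalChoi A B) := by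
  refine (isCompact_setOf_nonneg_re_trace_le (Fintype.card A)).of_isClosed_subset ?_ ?_
  · exact (isClosed_Ici (a := (0 : Matrix (B × A) (B × A) ℂ))).inter
      ((isClosed_eq (continuous_id.sub continuous_dephasing) continuous_const).inter
        (isClosed_eq continuous_partialTraceFst continuous_const))
  · rintro W ⟨h1, -, h3⟩
    refine ⟨h1, ?_⟩
    rw [← trace_partialTraceFst, h3]
    simp

variable {A B}

omit [Fintype A] in
/-- The Choi matrix of the deterministic classical channel `a ↦ β a`. -/
theorem diagonal_mem_classicalChoi (β : A → B) :
    Matrix.diagonal (fun x : B × A => if x.1 = β x.2 then (1 : ℂ) else 0) ∈ classicalChoi A B := by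
  refine ⟨?_, ?_, ?_⟩
  · refine (Matrix.PosSemidef.diagonal fun x => ?_).nonneg
    change (0 : ℂ) ≤ if _ then _ else _
    split_ifs <;> simp
  · rw [sub_eq_zero]
    exact (congrArg Matrix.diagonal (Matrix.diag_diagonal _)).symm
  · ext a a'
    simp only [partialTraceFst, Matrix.of_apply, Matrix.diagonal_apply, Prod.mk.injEq, true_and,
      Matrix.one_apply]
    split_ifs <;> simp

/-- The Lagrangian of the primal problem without the factor `2`, at `z = (Z, W)` and `y = (X, ρ)`:
maximizing over the states `ρ` gives the operator norm of `tr_B Z`, and `X` is the multiplier of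
`J - W ≤ Z`. -/
noncomputable def lagrangian (J : Matrix (B × A) (B × A) ℂ)
    (z : Matrix (B × A) (B × A) ℂ × Matrix (B × A) (B × A) ℂ)
    (y : Matrix (B × A) (B × A) ℂ × Matrix A A ℂ) : ℝ :=
  (partialTraceFst z.1 * y.2).trace.re + ((J - z.2 - z.1) * y.1).trace.re

omit [DecidableEq A] [DecidableEq B] in
theorem continuous_lagrangian (J : Matrix (B × A) (B × A) ℂ) :
    Continuous fun p : (Matrix (B × A) (B × A) ℂ × Matrix (B × A) (B × A) ℂ) ×
      (Matrix (B × A) (B × A) ℂ × Matrix A A ℂ) => lagrangian J p.1 p.2 := by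
  have := continuous_partialTraceFst (A := A) (B := B)
  unfold lagrangian
  fun_prop

omit [DecidableEq A] [DecidableEq B] in
theorem lagrangian_combo_left (J : Matrix (B × A) (B × A) ℂ)
    (z z' : Matrix (B × A) (B × A) ℂ × Matrix (B × A) (B × A) ℂ)
    (y : Matrix (B × A) (B × A) ℂ × Matrix A A ℂ) {a b : ℝ} (hab : a + b = 1) :
    lagrangian J (a • z + b • z') y = a * lagrangian J z y + b * lagrangian J z' y := by
  obtain rfl : b = 1 - a := by linarith
  simp only [lagrangian, Prod.fst_add, Prod.snd_add, Prod.smul_fst, Prod.smul_snd,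
    partialTraceFst_add, partialTraceFst_smul, Matrix.add_mul, Matrix.sub_mul, Matrix.smul_mul,
    Matrix.trace_add, Matrix.trace_sub, Complex.add_re, Complex.sub_re, re_trace_smul]
  ring

omit [DecidableEq A] [DecidableEq B] in
theorem lagrangian_combo_right (J : Matrix (B × A) (B × A) ℂ)
    (z : Matrix (B × A) (B × A) ℂ × Matrix (B × A) (B × A) ℂ)
    (y y' : Matrix (B × A) (B × A) ℂ × Matrix A A ℂ) (a b : ℝ) :
    lagrangian J z (a • y + b • y') = a * lagrangian J z y + b * lagrangian J z y' := by
  simp only [lagrangian, Prod.fst_add, Prod.snd_add, Prod.smul_fst, Prod.smul_snd,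
    Matrix.mul_add, Matrix.mul_smul, Matrix.trace_add, Complex.add_re, re_trace_smul]
  ring

theorem exists_saddlePoint_lagrangian [Nonempty A] [Nonempty B] (J : Matrix (B × A) (B × A) ℂ)
    {R : ℝ} (hR : 0 ≤ R) :
    ∃ z ∈ {Z : Matrix (B × A) (B × A) ℂ | 0 ≤ Z ∧ Z.trace.re ≤ R} ×ˢ classicalChoi A B,
      ∃ y ∈ Set.Icc (0 : Matrix (B × A) (B × A) ℂ) 1 ×ˢ states A,
        IsSaddlePointOn ({Z : Matrix (B × A) (B × A) ℂ | 0 ≤ Z ∧ Z.trace.re ≤ R} ×ˢ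
          classicalChoi A B) (Set.Icc (0 : Matrix (B × A) (B × A) ℂ) 1 ×ˢ states A)
          (lagrangian J) z y := by
  have hcZ : Convex ℝ {Z : Matrix (B × A) (B × A) ℂ | 0 ≤ Z ∧ Z.trace.re ≤ R} := by
    rintro Z ⟨h1, h2⟩ Z' ⟨h3, h4⟩ a b ha hb hab
    refine ⟨add_nonneg (smul_nonneg ha h1) (smul_nonneg hb h3), ?_⟩
    rw [Matrix.trace_add, Complex.add_re, re_trace_smul, re_trace_smul]
    calc a * Z.trace.re + b * Z'.trace.re ≤ a * R + b * R := by gcongr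
      _ = R := by rw [← add_mul, hab, one_mul]
  have hcz := hcZ.prod (convex_classicalChoi A B)
  have hcy := (convex_Icc (0 : Matrix (B × A) (B × A) ℂ) 1 (𝕜 := ℝ)).prod (convex_states A)
  refine Sion.exists_isSaddlePointOn
    ⟨(0, _), ⟨le_rfl, by simpa using hR⟩,
      diagonal_mem_classicalChoi fun _ => Classical.arbitrary B⟩ hcz
    ((isCompact_setOf_nonneg_re_trace_le R).prod (isCompact_classicalChoi A B)) ?_ ?_ hcy
    ⟨(0, _), ⟨le_rfl, zero_le_one⟩, inv_card_smul_one_mem_states⟩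
    ((isCompact_Icc_zero_one (B × A)).prod (isCompact_states A)) ?_ ?_
  · intro y _
    exact ((continuous_lagrangian J).comp
      (Continuous.prodMk_left y)).lowerSemicontinuous.lowerSemicontinuousOn _
  · intro y _
    exact ConvexOn.quasiconvexOn ⟨hcz, fun z _ z' _ a b _ _ hab =>
      (lagrangian_combo_left J z z' y hab).le⟩
  · intro z _
    exact ((continuous_lagrangian J).comp
      (Continuous.prodMk_right z)).upperSemicontinuous.upperSemicontinuousOn _
  · intro z _
    exact ConcaveOn.quasiconcaveOn ⟨hcy, fun y _ y' _ a b _ _ _ =>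
      (lagrangian_combo_right J z y y' a b).ge⟩

end Minimax

/-! ### Duality -/

section Duality
variable {A B : Type*} [Fintype A] [DecidableEq A] [Fintype B] [DecidableEq B]

/-- **Strong duality.** A saddle point of the Lagrangian gives feasible points `(Z, W)` and
`(X, Y₂, ρ)` with equal values. The dual constraint on `Y₁` and `Y₂` only concerns the diagonal
and is stated in terms of `Y₂ = diag y`. -/
theorem exists_primal_dual_optimal [Nonempty A] [Nonempty B] {J : Matrix (B × A) (B × A) ℂ}
    (hJ : 0 ≤ J) : ∃ (Z W X : Matrix (B × A) (B × A) ℂ) (y : A → ℝ) (ρ : Matrix A A ℂ),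
      J - W ≤ Z ∧ W ∈ classicalChoi A B ∧ 0 ≤ Z ∧
      X ≤ (1 : Matrix B B ℂ) ⊗ₖ ρ ∧ ρ ∈ states A ∧ 0 ≤ X ∧
      (∀ b a, (X (b, a) (b, a)).re ≤ y a) ∧
      operatorNorm (partialTraceFst Z) ≤ (J * X).trace.re - ∑ a, y a := by
  -- the bound on `Z` has to exceed the trace of every optimal `Z`, so that it is never active
  obtain ⟨⟨Z, W⟩, ⟨⟨hZ, -⟩, hW⟩, ⟨X, ρ⟩, ⟨⟨hX0, hX1⟩, hρ⟩, hs⟩ :=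
    exists_saddlePoint_lagrangian J (R := Fintype.card A * J.trace.re + 1)
      (add_nonneg (mul_nonneg (Nat.cast_nonneg _) (re_trace_nonneg hJ)) zero_le_one)
  dsimp only at hZ hW hX0 hX1 hρ
  have hR : 0 ≤ Fintype.card A * J.trace.re + 1 :=
    add_nonneg (mul_nonneg (Nat.cast_nonneg _) (re_trace_nonneg hJ)) zero_le_one
  -- the saddle point inequality against the competitor `(0, V)`
  have hle : ∀ V ∈ classicalChoi A B, ∀ P : Matrix (B × A) (B × A) ℂ, 0 ≤ P → P ≤ 1 →
      ∀ σ ∈ states A, (partialTraceFst Z * σ).trace.re + ((J - W - Z) * P).trace.re ≤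
        ((J - V) * X).trace.re := by
    intro V hV P hP0 hP1 σ hσ
    have := hs (0, V) ⟨⟨le_rfl, by simpa using hR⟩, hV⟩ (P, σ) ⟨⟨hP0, hP1⟩, hσ⟩
    have h0 : partialTraceFst (0 : Matrix (B × A) (B × A) ℂ) = 0 := by
      ext a a'
      simp [partialTraceFst]
    simpa [lagrangian, h0] using this
  have hZtr : Z.trace.re ≤ Fintype.card A * J.trace.re := by
    have h1 := hle W hW 0 le_rfl zero_le_one _ inv_card_smul_one_mem_states
    have h2 := re_trace_mul_nonneg hW.1 hX0
    have h3 := re_trace_mul_le_right hX1 hJ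
    rw [Matrix.mul_smul, mul_one, re_trace_smul, trace_partialTraceFst, Matrix.mul_zero,
      Matrix.trace_zero, Complex.zero_re, add_zero, Matrix.sub_mul, Matrix.trace_sub,
      Complex.sub_re, inv_mul_le_iff₀ (Nat.cast_pos.mpr Fintype.card_pos)] at h1
    rw [mul_one] at h3
    exact h1.trans (mul_le_mul_of_nonneg_left (by linarith) (Nat.cast_nonneg _))
  -- moving `Z` along any direction of the positive cone cannot decrease the Lagrangian
  have hXρ : X ≤ (1 : Matrix B B ℂ) ⊗ₖ ρ := by
    have hρh : ρ.IsHermitian := (Matrix.nonneg_iff_posSemidef.mp hρ.1).isHermitian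
    have hXh : X.IsHermitian := (Matrix.nonneg_iff_posSemidef.mp hX0).isHermitian
    rw [← sub_nonneg]
    refine nonneg_of_re_trace_mul_nonneg ?_ fun Y hY => ?_
    · refine Matrix.IsHermitian.sub ?_ hXh
      rw [Matrix.IsHermitian, Matrix.conjTranspose_kronecker, hρh, Matrix.conjTranspose_one]
    have hY0 := re_trace_nonneg hY
    have ht : 0 < (1 + Y.trace.re)⁻¹ := by positivity
    have hmem : (Z + (1 + Y.trace.re)⁻¹ • Y, W) ∈
        {Z : Matrix (B × A) (B × A) ℂ | 0 ≤ Z ∧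
          Z.trace.re ≤ Fintype.card A * J.trace.re + 1} ×ˢ classicalChoi A B := by
      refine ⟨⟨add_nonneg hZ (smul_nonneg ht.le hY), ?_⟩, hW⟩
      have : (1 + Y.trace.re)⁻¹ * Y.trace.re ≤ 1 := by
        rw [inv_mul_le_iff₀ (by positivity)]
        linarith
      dsimp only
      rw [Matrix.trace_add, Complex.add_re, re_trace_smul]
      linarith
    have h1 := hs _ hmem (X, ρ) ⟨⟨hX0, hX1⟩, hρ⟩
    simp only [lagrangian, partialTraceFst_add, partialTraceFst_smul, Matrix.add_mul,
      Matrix.sub_mul, Matrix.smul_mul, Matrix.trace_add, Matrix.trace_sub, Complex.add_re,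
      Complex.sub_re, re_trace_smul] at h1
    rw [Matrix.mul_sub, Matrix.trace_sub, Complex.sub_re, trace_mul_one_kronecker]
    refine nonneg_of_mul_nonneg_right (a := (1 + Y.trace.re)⁻¹) ?_ ht
    linarith
  -- the best response of `W` is the deterministic channel that picks the largest entry
  choose β hβ using fun a : A => Finite.exists_max fun b : B => (X (b, a) (b, a)).re
  obtain ⟨P, N, hP0, hP1, hN, hDN, hDP⟩ := exists_posPart (D := J - W - Z)
    (((Matrix.nonneg_iff_posSemidef.mp hJ).isHermitian.sub
      (Matrix.nonneg_iff_posSemidef.mp hW.1).isHermitian).sub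
      (Matrix.nonneg_iff_posSemidef.mp hZ).isHermitian)
  refine ⟨Z + N, W, X, fun a => (X (β a, a) (β a, a)).re, ρ, ?_, hW, add_nonneg hZ hN, hXρ, hρ,
    hX0, fun b a => hβ a b, ?_⟩
  · rwa [← sub_le_iff_le_add']
  -- violating `J - W ≤ Z` does not pay: the penalty is at least the cost of repairing `Z`
  refine operatorNorm_le_of_forall_states (partialTraceFst_nonneg (add_nonneg hZ hN))
    fun σ hσ => ?_
  have h1 := hle _ (diagonal_mem_classicalChoi β) P hP0 hP1 σ hσ
  -- the cost of the repair is at most `tr N`, as `σ ≤ 1`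
  have h2 : (partialTraceFst N * σ).trace.re ≤ N.trace.re := by
    rw [← trace_mul_one_kronecker]
    have := re_trace_mul_le_right (one_kronecker_mono (B := B) (le_one_of_mem_states hσ)) hN
    rwa [Matrix.one_kronecker_one, mul_one] at this
  have h3 : (Matrix.diagonal (fun x : B × A => if x.1 = β x.2 then (1 : ℂ) else 0) * X).trace.re =
      ∑ a, (X (β a, a) (β a, a)).re := by
    simp only [Matrix.trace, Matrix.diag_apply, Matrix.diagonal_mul, ite_mul, one_mul, zero_mul,
      Fintype.sum_prod_type_right, Finset.sum_ite_eq', Finset.mem_univ, if_true, Complex.re_sum]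
  rw [hDP, Matrix.sub_mul, Matrix.trace_sub, Complex.sub_re, h3] at h1
  rw [partialTraceFst_add, Matrix.add_mul, Matrix.trace_add, Complex.add_re]
  linarith

variable {Θ Φ : Matrix A A ℂ →ₗ[ℂ] Matrix B B ℂ}

/-- **Weak duality**, with the primal problem replaced by the minimization of the diamond norm. -/
theorem DualFeasible.le_diamondNorm {X Y₁ : Matrix (B × A) (B × A) ℂ} {Y₂ ρ : Matrix A A ℂ}
    (h : DualFeasible X Y₁ Y₂ ρ) (hΘ : IsQuantumOperation Θ) (hΦ : Φ ∈ detectionIncoherent A B) :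
    2 * ((choi (dephasing B ∘ₗ Θ) * X).trace - Y₂.trace).re ≤
      diamondNorm (dephasing B ∘ₗ Θ - dephasing B ∘ₗ Φ) := by
  set J := choi (dephasing B ∘ₗ Θ) with hJ
  set W := choi (dephasing B ∘ₗ Φ) with hW
  have hJ0 : 0 ≤ J := hΘ.choi_dephasing_comp_nonneg
  have hW0 : 0 ≤ W := hΦ.1.choi_dephasing_comp_nonneg
  have hWd : W - dephasing (B × A) W = 0 := dephasing_choi_of_mem_detectionIncoherent hΦ
  have hW1 : partialTraceFst W = 1 := hΦ.1.partialTraceFst_choi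
  -- pairing the diagonal matrix `W` with the dual constraint makes `Y₁` disappear
  have h1 := re_trace_mul_nonneg hW0 h.nonneg
  have h2 : (W * (Y₁ - dephasing (B × A) Y₁)).trace = 0 := by
    rw [sub_eq_zero] at hWd
    rw [hWd]
    simp only [Matrix.trace, Matrix.diag_apply, Matrix.mul_apply, dephasing_apply, ite_mul,
      zero_mul, Finset.sum_ite_eq, Finset.mem_univ, if_true, Matrix.sub_apply, sub_self, mul_zero,
      Finset.sum_const_zero]
  rw [Matrix.mul_add, Matrix.mul_sub, Matrix.trace_add, Matrix.trace_sub, h2,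
    trace_mul_one_kronecker, hW1, one_mul, Complex.add_re, Complex.sub_re, Complex.zero_re] at h1
  have hch : choi (dephasing B ∘ₗ Θ - dephasing B ∘ₗ Φ) = J - W := choi_sub _ _
  have h3 := two_mul_re_trace_choi_mul_le_diamondNorm
    (Λ := dephasing B ∘ₗ Θ - dephasing B ∘ₗ Φ) (Z := J) (X := X) (ρ := ρ)
    (by
      rw [hch]
      exact (Matrix.nonneg_iff_posSemidef.mp hJ0).isHermitian.sub
        (Matrix.nonneg_iff_posSemidef.mp hW0).isHermitian)
    hJ0 (by rw [hch]; exact sub_le_self _ hW0)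
    (by rw [hch, partialTraceFst_sub, hΘ.partialTraceFst_choi, hW1, sub_self])
    h.X_nonneg h.X_le h.ρ_nonneg h.trace_ρ
  rw [hch, Matrix.sub_mul, Matrix.trace_sub, Complex.sub_re] at h3
  rw [Complex.sub_re]
  linarith

/-- A primal feasible `W` is the Choi matrix of a classical channel whose distance to `ΔΘ` is at
most the value of the primal objective. -/
theorem PrimalFeasible.exists_diamondDistance_le {Z W : Matrix (B × A) (B × A) ℂ}
    (h : PrimalFeasible Θ Z W) (hΘ : IsQuantumOperation Θ) :
    ∃ r ∈ diamondDistances Θ, r ≤ 2 * operatorNorm (partialTraceFst Z) := by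
  refine ⟨_, ⟨ofChoi W, ofChoi_mem_detectionIncoherent h.dephasing_W h.W_nonneg h.trace_W, rfl⟩,
    diamondNorm_le h.Z_nonneg ?_ ?_⟩
  · rw [choi_sub, dephasing_comp_ofChoi h.dephasing_W, choi_ofChoi]
    exact h.le_Z
  · rw [choi_sub, dephasing_comp_ofChoi h.dephasing_W, choi_ofChoi, partialTraceFst_sub,
      hΘ.partialTraceFst_choi, h.trace_W, sub_self]

/-- A bound on the diagonal of `X` can be completed to a feasible point of the dual problem: the
choice `Y₁ = X - 1 ⊗ Y₂` removes all off-diagonal entries from the constraint. -/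
theorem dualFeasible_of_diag_le {X : Matrix (B × A) (B × A) ℂ} {ρ : Matrix A A ℂ} {y : A → ℝ}
    (hXρ : X ≤ (1 : Matrix B B ℂ) ⊗ₖ ρ) (hρ : ρ ∈ states A) (hX : 0 ≤ X)
    (hy : ∀ b a, (X (b, a) (b, a)).re ≤ y a) :
    DualFeasible X (X - (1 : Matrix B B ℂ) ⊗ₖ Matrix.diagonal fun a => (y a : ℂ))
      (Matrix.diagonal fun a => (y a : ℂ)) ρ := by
  have hd : (Matrix.diagonal fun a => (y a : ℂ))ᴴ = Matrix.diagonal fun a => (y a : ℂ) := by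
    rw [Matrix.diagonal_conjTranspose]
    congr 1
    ext a
    simp
  have hXh : X.IsHermitian := (Matrix.nonneg_iff_posSemidef.mp hX).isHermitian
  refine ⟨hXρ, hρ.1, hρ.2, ?_, hX, ?_, hd.symm⟩
  · set E := (1 : Matrix B B ℂ) ⊗ₖ Matrix.diagonal fun a => (y a : ℂ) with hE
    have : X - E - dephasing (B × A) (X - E) - X + E = -dephasing (B × A) (X - E) := by abel
    rw [this, ← map_neg, neg_sub]
    refine (Matrix.PosSemidef.diagonal (d := (E - X).diag) fun x => ?_).nonneg
    obtain ⟨b, a⟩ := x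
    have him : (X (b, a) (b, a)).im = 0 := by
      have := (Matrix.nonneg_iff_posSemidef.mp hX).diag_nonneg (i := (b, a))
      exact (Complex.le_def.mp this).2.symm
    have := hy b a
    refine Complex.le_def.mpr ⟨?_, ?_⟩
    · simpa [hE] using this
    · simp [hE, him]
  · rw [Matrix.conjTranspose_sub, hXh, Matrix.conjTranspose_kronecker, hd,
      Matrix.conjTranspose_one]

theorem exists_primalStrictlyFeasible [Nonempty B] (hΘ : IsQuantumOperation Θ) :
    ∃ Z W : Matrix (B × A) (B × A) ℂ, PrimalStrictlyFeasible Θ Z W := by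
  have hJ := Matrix.nonneg_iff_posSemidef.mp hΘ.choi_dephasing_comp_nonneg
  have hc : (0 : ℝ) < (Fintype.card B : ℝ)⁻¹ :=
    inv_pos.mpr (Nat.cast_pos.mpr Fintype.card_pos)
  have hW : ((Fintype.card B : ℝ)⁻¹ • (1 : Matrix (B × A) (B × A) ℂ)).PosDef :=
    Matrix.PosDef.one.smul hc
  refine ⟨choi (dephasing B ∘ₗ Θ) + 1, (Fintype.card B : ℝ)⁻¹ • 1, ?_, ?_, ?_, ?_, hW⟩
  · have : choi (dephasing B ∘ₗ Θ) + 1 -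
        (choi (dephasing B ∘ₗ Θ) - (Fintype.card B : ℝ)⁻¹ • (1 : Matrix (B × A) (B × A) ℂ)) =
        1 + (Fintype.card B : ℝ)⁻¹ • (1 : Matrix (B × A) (B × A) ℂ) := by abel
    rw [this]
    exact Matrix.PosDef.one.add hW
  · rw [sub_eq_zero]
    ext i j
    rw [dephasing_apply]
    split_ifs with hij
    · rfl
    · simp [Matrix.one_apply_ne hij]
  · ext a a'
    simp [partialTraceFst, Matrix.one_apply]
  · rw [add_comm]
    exact Matrix.PosDef.one.add_posSemidef hJ

end Duality
end CoherenceSDP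

theorem mainTheorem6 {A B : Type*} [Fintype A] [DecidableEq A] [Nonempty A]
    [Fintype B] [DecidableEq B]
    (Θ : Matrix A A ℂ →ₗ[ℂ] Matrix B B ℂ) (hΘ : CoherenceSDP.IsQuantumOperation Θ) :
    -- the minimum defining the diamond-measure exists
    IsLeast (CoherenceSDP.diamondDistances Θ) (CoherenceSDP.diamondMeasure Θ) ∧
    -- the diamond-measure is the optimal value of the primal problem
    IsLeast (CoherenceSDP.primalValues Θ) (CoherenceSDP.diamondMeasure Θ) ∧
    -- the dual problem has the same optimal value
    IsGreatest (CoherenceSDP.dualValues Θ) (CoherenceSDP.diamondMeasure Θ) ∧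
    -- the primal problem has a strictly feasible point
    ∃ Z W : Matrix (B × A) (B × A) ℂ, CoherenceSDP.PrimalStrictlyFeasible Θ Z W := by
  open CoherenceSDP in
  -- `B` is not assumed nonempty; trace preservation excludes an empty output system
  have hB : Nonempty B := by
    by_contra hB
    rw [not_nonempty_iff] at hB
    have := hΘ.tracePreserving 1
    rw [Matrix.trace_one, Matrix.trace, Finset.univ_eq_empty, Finset.sum_empty] at this
    exact Fintype.card_ne_zero (Nat.cast_eq_zero.mp this.symm)
  obtain ⟨Z, W, X, y, ρ, hle, hW, hZ, hXρ, hρ, hX, hy, hval⟩ :=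
    exists_primal_dual_optimal hΘ.choi_dephasing_comp_nonneg
  have hP : PrimalFeasible Θ Z W := ⟨hle, hW.2.1, hW.2.2, hZ, hW.1⟩
  have hD := dualFeasible_of_diag_le hXρ hρ hX hy
  obtain ⟨m, hm, hmZ⟩ := hP.exists_diamondDistance_le hΘ
  have htr : (Matrix.diagonal fun a => (y a : ℂ)).trace.re = ∑ a, y a := by
    simp [Matrix.trace_diagonal]
  -- every dual value is at most every diamond distance
  have hweak : ∀ d ∈ dualValues Θ, ∀ r ∈ diamondDistances Θ, d ≤ r := by
    rintro d ⟨X, Y₁, Y₂, ρ, h, rfl⟩ r ⟨Φ, hΦ, rfl⟩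
    exact h.le_diamondNorm hΘ hΦ
  have hd : 2 * ((choi (dephasing B ∘ₗ Θ) * X).trace -
      (Matrix.diagonal fun a => (y a : ℂ)).trace).re ∈ dualValues Θ := ⟨_, _, _, _, hD, rfl⟩
  have hZd : 2 * operatorNorm (partialTraceFst Z) ≤
      2 * ((choi (dephasing B ∘ₗ Θ) * X).trace -
        (Matrix.diagonal fun a => (y a : ℂ)).trace).re := by
    rw [Complex.sub_re, htr]
    linarith
  have hleast : IsLeast (diamondDistances Θ) m :=
    ⟨hm, fun r hr => (hmZ.trans hZd).trans (hweak _ hd r hr)⟩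
  have hmeas : diamondMeasure Θ = m := hleast.csInf_eq
  have hmZ' : m = 2 * operatorNorm (partialTraceFst Z) :=
    le_antisymm hmZ (hZd.trans (hweak _ hd m hm))
  rw [hmeas]
  refine ⟨hleast, ⟨⟨Z, W, hP, hmZ'⟩, ?_⟩, ⟨?_, fun d hd' => hweak d hd' m hm⟩,
    exists_primalStrictlyFeasible hΘ⟩
  · rintro r ⟨Z', W', hP', rfl⟩
    obtain ⟨s, hs, hsZ⟩ := hP'.exists_diamondDistance_le hΘ
    exact (hleast.2 hs).trans hsZ
  · rw [le_antisymm (hmZ.trans hZd) (hweak _ hd m hm)]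
    exact hd
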